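/- Let $p$ be a prime, let $K$ be a field of characteristic $p$ with $[K:K^p]<\infty$, let $n\ge 1$ and let $d_1,\dots,d_n$ be positive integers. Let $f=x_1^{d_1}\cdots x_n^{d_n}\in S=K[[x_1,\dots,x_n]]$, let $d=\max\{d_1,\dots,d_n\}$, and for $1\le s\le n-1$ put $$W_s=\sum_{\substack{J\subseteq\{1,\dots,n\}\\ |J|=s}}\ \prod_{j\in J}(d-d_j)\prod_{j\notin J}d_j .$$ Then the ring $R=S[[u,v]]/(f+uv)$, where $u,v$ are variables over $S$, is an F-finite Noetherian local ring of characteristic $p$, and its F-signature exists and equals $$\mathbb{S}(R)=\frac{2}{d^{\,n+1}}\left[\frac{d_1d_2\cdots d_n}{n+1}+\sum_{s=1}^{n-1}\frac{W_s}{n-s+1}\right].$$ Here the F-signature of an F-finite Noetherian local ring $R$ of characteristic $p$, of Krull dimension $\delta$ and with residue field $k$, is $$\mathbb{S}(R)=\lim_{e\to\infty}\frac{a_e}{p^{e(\delta+\alpha)}},\qquad \alpha=\log_p[k:k^p],$$ where $a_e$ is the maximal rank of a free direct summand of the $R$-module $F_*^e(R)$, that is, of the additive group of $R$ on which $r\in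 R$ acts as multiplication by $r^{p^e}$. -/

import Mathlib

/-- The `R`-module `F_*^e(R)`: the additive group of `R`, on which `r : R` acts as
multiplication by `r ^ (p ^ e)`. -/
@[nolint unusedArguments]
def FrobeniusPushforward (_p _e : ℕ) (R : Type*) : Type _ := R

instance FrobeniusPushforward.instAddCommGroup (p e : ℕ) (R : Type*) [CommRing R] :
    AddCommGroup (FrobeniusPushforward p e R) :=
  inferInstanceAs (AddCommGroup R)

noncomputable instance FrobeniusPushforward.instModule (p e : ℕ) (R : Type*) [CommRing R]
    [ExpChar R p] : Module R (FrobeniusPushforward p e R) :=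
  Module.compHom R (iterateFrobenius R p e)

theorem FrobeniusPushforward.smul_def (p e : ℕ) (R : Type*) [CommRing R] [ExpChar R p]
    (r : R) (m : FrobeniusPushforward p e R) :
    r • m = (show FrobeniusPushforward p e R from (r ^ (p ^ e) * (show R from m) : R)) :=
  rfl

/-- A ring `R` of characteristic `p` is F-finite if `F_*^1(R)` is a finitely generated
`R`-module. -/
def IsFFinite (p : ℕ) (R : Type*) [CommRing R] [ExpChar R p] : Prop :=
  Module.Finite R (FrobeniusPushforward p 1 R)

/-- `M` has a direct summand that is free of rank `a`. -/
def HasFreeSummandOfRank (R M : Type*) [CommRing R] [AddCommGroup M] [Module R M] (a : ℕ) :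
    Prop :=
  ∃ P Q : Submodule R M, IsCompl P Q ∧ Nonempty (P ≃ₗ[R] (Fin a → R))

/-- `a` is the maximal rank of a free direct summand of `M`. -/
def IsMaxFreeRank (R M : Type*) [CommRing R] [AddCommGroup M] [Module R M] (a : ℕ) : Prop :=
  IsGreatest {b : ℕ | HasFreeSummandOfRank R M b} a

/-- The residue field of a local ring of prime characteristic `p` has characteristic `p`. -/
instance residueField_charP (p : ℕ) [Fact p.Prime] (R : Type*) [CommRing R] [IsLocalRing R]
    [CharP R p] : CharP (IsLocalRing.ResidueField R) p :=
  (CharP.charP_iff_prime_eq_zero Fact.out).2 <| by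
    rw [← map_natCast (IsLocalRing.residue R), CharP.cast_eq_zero, map_zero]

/-- `[k : k^p]` for a field `k` of characteristic `p`. -/
noncomputable def frobeniusDegree (p : ℕ) (k : Type*) [Field k] [ExpChar k p] : ℕ :=
  Module.finrank (frobenius k p).fieldRange k

/-- The local ring `R` of characteristic `p` has F-signature `s`: if `δ` is the Krull dimension
of `R`, `k` its residue field and `α = log_p [k : k^p]`, then the maximal ranks `a e` of the free
direct summands of `F_*^e(R)` satisfy `a e / p ^ (e (δ + α)) → s`. The rings to which it is
applied are Noetherian and F-finite. -/
def HasFSignature (p : ℕ) [Fact p.Prime] (R : Type*) [CommRing R] [IsLocalRing R] [CharP R p]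
    (s : ℝ) : Prop :=
  ∃ (δ : ℕ) (a : ℕ → ℕ),
    ringKrullDim R = δ ∧
    (∀ e, IsMaxFreeRank R (FrobeniusPushforward p e R) (a e)) ∧
    Filter.Tendsto
      (fun e : ℕ => (a e : ℝ) / (p : ℝ) ^ ((e : ℝ) *
        ((δ : ℝ) + Real.logb p (frobeniusDegree p (IsLocalRing.ResidueField R)))))
      Filter.atTop (nhds s)

/-- The monomial `x_1^{d_1} ⋯ x_n^{d_n}` in `K[[x_1, …, x_n]]`. -/
noncomputable def powerSeriesMonomial (K : Type*) [Field K] {n : ℕ} (D : Fin n → ℕ) :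
    MvPowerSeries (Fin n) K :=
  ∏ j, MvPowerSeries.X j ^ D j

/-- The ring `S[[u, v]] / (f + u v)`. -/
abbrev DoubleSuspension (S : Type*) [CommRing S] (f : S) : Type _ :=
  MvPowerSeries (Fin 2) S ⧸
    (Ideal.span {MvPowerSeries.C f + MvPowerSeries.X 0 * MvPowerSeries.X 1} :
      Ideal (MvPowerSeries (Fin 2) S))

/-- `W_s = ∑_{J ⊆ {1, …, n}, |J| = s} ∏_{j ∈ J} (d - d_j) ∏_{j ∉ J} d_j`. -/
noncomputable def symmW {n : ℕ} (d : ℝ) (D : Fin n → ℝ) (s : ℕ) : ℝ :=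
  ∑ J ∈ Finset.powersetCard s (Finset.univ : Finset (Fin n)),
    (∏ j ∈ J, (d - D j)) * ∏ j ∈ Finset.univ \ J, D j

/-! Put q = p^e, T = K[[x]][[u,v]], g = f + uv, R = T/(g). The classes of λ x^a u^b v^c, with λ in a
basis of K over K^q and exponents below q, generate F_*^e(R). As uv = -f in R, each is up to sign
some λ x^a u^c or λ x^a v^(-c), with c in (-q, q) and a possibly large. These generators fall into
two kinds.

If a_j + |c| d_j < q for all j, the generator belongs to a family with dual linear forms. Let h = ∑
(-f)^i (uv)^(q-1-i); then h g = g^q, so t ↦ π(h t) descends to R for each coordinate function π of T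
over T^q. Suitable π give forms dual to these generators (`hasFreeSummandOfRank_suspension`).

If a_j + |c| d_j ≥ q for some j, every linear form φ is a nonunit on the generator m: for c ≥ 0, v^q
x^a u^c = ± x^a f^c v^(q-c) in R is divisible by x_j^q, so v φ(m) ∈ (x_j), while x_j does not divide
v in R. For c ≤ 0 use u.

Hence a_e = [K:K^p]^e ∑_{|c|<q} ∏_j max(0, q - d_j |c|). The count divided by q^(n+1) is a Riemann
sum tending to 2 ∫_0^1 ∏_j max(0, 1 - d_j t) dt. The integrand vanishes beyond 1/d, and s = 1 - dt
turns it into d^(-n) ∏_j ((d - d_j) + d_j s), whose coefficients in s are the W_s. -/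

/-! ### Bases over the subring of q-th powers -/

/-- The elements `b i` form a basis of `A` over its subring of `q`-th powers, and `π i` takes an
element to the `q`-th root of its `i`-th coordinate. -/
structure IsFrobeniusBasis (q : ℕ) {ι A : Type*} [Fintype ι] [CommRing A]
    (b : ι → A) (π : ι → A →+ A) : Prop where
  coord_pow_mul : ∀ i r s, π i (r ^ q * s) = r * π i s
  coord_self : ∀ i, π i (b i) = 1
  coord_of_ne : ∀ i j, i ≠ j → π i (b j) = 0
  sum_coord : ∀ s, ∑ i, π i s ^ q * b i = s

namespace IsFrobeniusBasis

variable {q q' : ℕ} {ι κ A : Type*} [Fintype ι] [Fintype κ] [CommRing A]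
  {b : ι → A} {π : ι → A →+ A} {b' : κ → A} {π' : κ → A →+ A}

theorem one : IsFrobeniusBasis 1 (fun _ : Unit => (1 : A)) (fun _ => AddMonoidHom.id A) where
  coord_pow_mul := by simp
  coord_self := by simp
  coord_of_ne i j h := (h (Subsingleton.elim _ _)).elim
  sum_coord := by simp

/-- Bases over the `q`-th and over the `q'`-th powers give one over the `q * q'`-th powers. -/
theorem comp [ExpChar A q'] (h : IsFrobeniusBasis q b π) (h' : IsFrobeniusBasis q' b' π') :
    IsFrobeniusBasis (q * q') (fun x : ι × κ => b x.1 ^ q' * b' x.2)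
      (fun x => (π x.1).comp (π' x.2)) where
  coord_pow_mul i r s := by
    simp [pow_mul, h'.coord_pow_mul, h.coord_pow_mul]
  coord_self i := by
    simp [h'.coord_pow_mul, h'.coord_self, h.coord_self]
  coord_of_ne i j hij := by
    simp only [AddMonoidHom.comp_apply, h'.coord_pow_mul]
    by_cases h2 : i.2 = j.2
    · rw [h2, h'.coord_self, mul_one, h.coord_of_ne]
      exact fun h1 => hij (Prod.ext h1 h2)
    · rw [h'.coord_of_ne _ _ h2, mul_zero, map_zero]
  sum_coord s := by
    rw [Fintype.sum_prod_type_right]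
    conv_rhs => rw [← h'.sum_coord s]
    refine Finset.sum_congr rfl fun k _ => ?_
    conv_rhs => rw [← h.sum_coord (π' k s)]
    rw [sum_pow_char, Finset.sum_mul]
    refine Finset.sum_congr rfl fun i _ => ?_
    simp only [AddMonoidHom.comp_apply]
    ring

end IsFrobeniusBasis

theorem exists_isFrobeniusBasis_one (p : ℕ) [Fact p.Prime] (K : Type*) [Field K] [CharP K p]
    (hK : FiniteDimensional (frobenius K p).fieldRange K) :
    ∃ (b : Fin (frobeniusDegree p K) → K) (π : Fin (frobeniusDegree p K) → K →+ K),
      IsFrobeniusBasis p b π := by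
  let B : Module.Basis (Fin (frobeniusDegree p K)) (frobenius K p).fieldRange K :=
    Module.finBasis (frobenius K p).fieldRange K
  let ρ : K ≃+* (frobenius K p).fieldRange :=
    RingEquiv.ofBijective (frobenius K p).rangeRestrictField
      ⟨(frobenius K p).rangeRestrictField.injective, (frobenius K p).rangeRestrictField_bijective.2⟩
  have hρ : ∀ r : K, ((ρ r : (frobenius K p).fieldRange) : K) = r ^ p := fun r => rfl
  refine ⟨B, fun i => (ρ.symm : _ →+ K).comp
    ((B.coord i : K →ₗ[(frobenius K p).fieldRange] _).toAddMonoidHom), ?_, ?_, ?_, ?_⟩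
  · intro i r s
    have : r ^ p * s = ρ r • s := by rw [Subfield.smul_def, hρ, smul_eq_mul]
    simp [this]
  · intro i; simp
  · intro i j hij
    simp [hij.symm]
  · intro s
    conv_rhs => rw [← B.sum_repr s]
    refine Finset.sum_congr rfl fun i _ => ?_
    rw [← hρ, Subfield.smul_def, smul_eq_mul]
    simp

theorem exists_isFrobeniusBasis (p : ℕ) [Fact p.Prime] (K : Type*) [Field K] [CharP K p]
    (hK : FiniteDimensional (frobenius K p).fieldRange K) (e : ℕ) :
    ∃ (ι : Type) (_ : Fintype ι) (b : ι → K) (π : ι → K →+ K),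
      Fintype.card ι = frobeniusDegree p K ^ e ∧ IsFrobeniusBasis (p ^ e) b π := by
  induction e with
  | zero => exact ⟨Unit, inferInstance, _, _, by simp, by simpa using IsFrobeniusBasis.one⟩
  | succ e ih =>
    obtain ⟨ι, _, b, π, hc, h⟩ := ih
    obtain ⟨b', π', h'⟩ := exists_isFrobeniusBasis_one p K hK
    refine ⟨ι × Fin (frobeniusDegree p K), inferInstance, _, _, ?_, h.comp h'⟩
    simp [hc, pow_succ]

/-! ### Frobenius bases of power series rings -/

namespace MvPowerSeries

variable {σ A : Type*} [CommRing A]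

/-- `∑ c_γ X^γ` is sent to `∑ π (c_{α + q β}) X^β`. -/
noncomputable def decimate (q : ℕ) (α : σ →₀ ℕ) (π : A →+ A) :
    MvPowerSeries σ A →+ MvPowerSeries σ A where
  toFun F := fun β => π (coeff (α + q • β) F)
  map_zero' := funext fun β => by
    change π (coeff _ 0) = 0
    rw [map_zero, map_zero]
  map_add' F G := funext fun β => by
    change π (coeff _ (F + G)) = π (coeff _ F) + π (coeff _ G)
    rw [map_add, map_add]

theorem coeff_decimate (q : ℕ) (α β : σ →₀ ℕ) (π : A →+ A) (F : MvPowerSeries σ A) :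
    coeff β (decimate q α π F) = π (coeff (α + q • β) F) := rfl

theorem coeff_smul_pow_expChar_pow (p e : ℕ) [ExpChar A p] [Finite σ] (G : MvPowerSeries σ A)
    (m : σ →₀ ℕ) : coeff (p ^ e • m) (G ^ p ^ e) = coeff m G ^ p ^ e := by
  rw [← map_iterateFrobenius_expand p (expChar_ne_zero A p), coeff_map, coeff_expand_smul,
    iterateFrobenius_def]

theorem coeff_pow_expChar_pow_of_not_dvd (p e : ℕ) [ExpChar A p] [Finite σ]
    (G : MvPowerSeries σ A) {m : σ →₀ ℕ} {i : σ} (h : ¬ p ^ e ∣ m i) :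
    coeff m (G ^ p ^ e) = 0 := by
  rw [← map_iterateFrobenius_expand p (expChar_ne_zero A p), coeff_map,
    coeff_expand_of_not_dvd _ _ _ h, map_zero]

/-- Only exponents divisible by q occur in G^q. If α + qβ = qm + γ with α < q, then m ≤ β and γ = α
+ q(β - m), so the surviving terms match the antidiagonal of β. -/
theorem decimate_pow_mul (p e : ℕ) [ExpChar A p] [Finite σ] {π : A →+ A}
    (hπ : ∀ r s, π (r ^ p ^ e * s) = r * π s) {α : σ →₀ ℕ} (hα : ∀ i, α i < p ^ e)
    (G F : MvPowerSeries σ A) :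
    decimate (p ^ e) α π (G ^ p ^ e * F) = G * decimate (p ^ e) α π F := by
  classical
  have hq : 0 < p ^ e := pow_pos (expChar_pos A p) e
  ext β
  rw [coeff_decimate, coeff_mul, coeff_mul, map_sum]
  symm
  refine Finset.sum_of_injOn (fun x => (p ^ e • x.1, α + p ^ e • x.2)) ?_ ?_ ?_ ?_
  · intro x _ y _ hxy
    simp only [Prod.mk.injEq, add_right_inj] at hxy
    refine Prod.ext ?_ ?_ <;> ext i
    · exact Nat.eq_of_mul_eq_mul_left hq (by simpa using DFunLike.congr_fun hxy.1 i)
    · exact Nat.eq_of_mul_eq_mul_left hq (by simpa using DFunLike.congr_fun hxy.2 i)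
  · intro x hx
    simp only [Finset.mem_coe, Finset.HasAntidiagonal.mem_antidiagonal] at hx ⊢
    rw [← hx, smul_add]; abel
  · intro x hx hn
    by_cases hd : ∀ i, p ^ e ∣ x.1 i
    · exfalso
      choose m hm using hd
      rw [Finset.HasAntidiagonal.mem_antidiagonal] at hx
      have key : ∀ i, p ^ e * m i + x.2 i = α i + p ^ e * β i := fun i => by
        simpa [hm] using DFunLike.congr_fun hx i
      have hle : ∀ i, m i ≤ β i := fun i => by
        by_contra hlt
        push Not at hlt
        have h1 := Nat.mul_le_mul_left (p ^ e) (Nat.succ_le_of_lt hlt)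
        have h2 := key i
        have h3 := hα i
        rw [Nat.mul_succ] at h1
        omega
      apply hn
      have := Fintype.ofFinite σ
      refine ⟨(Finsupp.equivFunOnFinite.symm m, β - Finsupp.equivFunOnFinite.symm m), ?_, ?_⟩
      · simp only [Finset.mem_coe, Finset.HasAntidiagonal.mem_antidiagonal]
        ext i
        simp [hle i]
      · refine Prod.ext ?_ ?_ <;> ext i
        · simp [hm]
        · have h1 := key i
          have h2 := Nat.mul_le_mul_left (p ^ e) (hle i)
          simp [Nat.mul_sub]
          omega
    · push Not at hd
      obtain ⟨i, hi⟩ := hd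
      rw [coeff_pow_expChar_pow_of_not_dvd p e G hi, zero_mul, map_zero]
  · intro x _
    rw [coeff_smul_pow_expChar_pow, hπ, coeff_decimate]

/-- The exponent vector in `[0, q)^σ` as a finitely supported function. -/
noncomputable def expVec {σ : Type*} [Finite σ] {q : ℕ} (α : σ → Fin q) : σ →₀ ℕ :=
  Finsupp.equivFunOnFinite.symm fun i => (α i : ℕ)

@[simp]
theorem expVec_apply {σ : Type*} [Finite σ] {q : ℕ} (α : σ → Fin q) (i : σ) :
    expVec α i = α i := rfl

theorem decimate_monomial_of_not_modEq (q : ℕ) (π : A →+ A) {α γ : σ →₀ ℕ} {i : σ}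
    (h : ¬ γ i ≡ α i [MOD q]) (c : A) : decimate q α π (monomial γ c) = 0 := by
  classical
  ext β
  rw [coeff_decimate, coeff_monomial, if_neg, map_zero, coeff_zero]
  rintro rfl
  simp [Nat.ModEq] at h

theorem decimate_monomial_self {q : ℕ} (hq : 0 < q) (π : A →+ A) (α : σ →₀ ℕ) (c : A) :
    decimate q α π (monomial α c) = C (π c) := by
  classical
  ext β
  rw [coeff_decimate, coeff_monomial, coeff_C]
  by_cases h : β = 0
  · simp [h]
  · rw [if_neg, if_neg h, map_zero]
    intro h'
    apply h
    ext i
    have := DFunLike.congr_fun h' i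
    simpa [hq.ne'] using this

end MvPowerSeries

-- Division with remainder writes each exponent uniquely as α + qβ with α in [0, q)^σ.
open MvPowerSeries in
theorem IsFrobeniusBasis.mvPowerSeries {p e : ℕ} {ι A σ : Type*} [Fintype ι] [CommRing A]
    [ExpChar A p] [Fintype σ] [DecidableEq σ] {b : ι → A} {π : ι → A →+ A}
    (h : IsFrobeniusBasis (p ^ e) b π) :
    IsFrobeniusBasis (p ^ e)
      (fun x : ι × (σ → Fin (p ^ e)) => (monomial (expVec x.2) (b x.1) : MvPowerSeries σ A))
      (fun x => decimate (p ^ e) (expVec x.2) (π x.1)) where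
  coord_pow_mul x := decimate_pow_mul p e (h.coord_pow_mul x.1) fun i => by simp
  coord_self x := by
    rw [decimate_monomial_self (pow_pos (expChar_pos A p) e), h.coord_self, map_one]
  coord_of_ne x y hxy := by
    by_cases h2 : y.2 = x.2
    · rw [h2, decimate_monomial_self (pow_pos (expChar_pos A p) e), h.coord_of_ne, map_zero]
      exact fun h1 => hxy (Prod.ext h1 h2.symm)
    · obtain ⟨i, hi⟩ := Function.ne_iff.1 h2
      refine decimate_monomial_of_not_modEq (i := i) _ _ (fun hm => hi ?_) _
      exact Fin.ext (hm.eq_of_lt_of_lt (y.2 i).2 (x.2 i).2)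
  sum_coord F := by
    have hq : 0 < p ^ e := pow_pos (expChar_pos A p) e
    ext γ
    let α₀ : σ → Fin (p ^ e) := fun i => ⟨γ i % p ^ e, Nat.mod_lt _ hq⟩
    let β₀ : σ →₀ ℕ := Finsupp.equivFunOnFinite.symm fun i => γ i / p ^ e
    have hγ : expVec α₀ + p ^ e • β₀ = γ := by
      ext i
      simp [α₀, β₀, Nat.mod_add_div]
    rw [map_sum, Fintype.sum_prod_type_right, Finset.sum_eq_single α₀]
    · rw [← h.sum_coord (coeff γ F)]
      refine Finset.sum_congr rfl fun i _ => ?_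
      rw [coeff_mul_monomial, if_pos (by rw [← hγ]; exact le_self_add)]
      congr 1
      conv_lhs => rw [← hγ]
      rw [add_tsub_cancel_left, coeff_smul_pow_expChar_pow, coeff_decimate, hγ]
    · intro α _ hα
      refine Finset.sum_eq_zero fun i _ => ?_
      rw [coeff_mul_monomial]
      split_ifs with hle
      · obtain ⟨j, hj⟩ := Function.ne_iff.1 hα
        rw [coeff_pow_expChar_pow_of_not_dvd p e _ (i := j), zero_mul]
        intro hdvd
        apply hj
        have h1 := (Nat.modEq_iff_dvd' (hle j)).2 (by simpa using hdvd)
        refine Fin.ext ?_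
        have h2 : (expVec α) j % p ^ e = γ j % p ^ e := h1
        rw [expVec_apply, Nat.mod_eq_of_lt (α j).2] at h2
        exact h2
      · rfl
    · simp

/-! ### Bounds for the rank of a free summand -/

section FreeSummand

variable {R M : Type*} [CommRing R] [AddCommGroup M] [Module R M]

/-- A finite family of elements with a dual family of linear forms spans a free summand. -/
theorem hasFreeSummandOfRank_of_dual {κ : Type*} [Fintype κ] [DecidableEq κ] (x : κ → M)
    (φ : κ → M →ₗ[R] R) (h : ∀ k l, φ k (x l) = if k = l then 1 else 0) :
    HasFreeSummandOfRank R M (Fintype.card κ) := by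
  let Φ : M →ₗ[R] (κ → R) := LinearMap.pi φ
  let Ψ : (κ → R) →ₗ[R] M := Fintype.linearCombination R x
  have hΦΨ : Φ ∘ₗ Ψ = LinearMap.id := by
    refine LinearMap.ext fun v => funext fun k => ?_
    simp [Φ, Ψ, Fintype.linearCombination_apply, h]
  have hinj : Function.Injective Ψ := by
    refine Function.LeftInverse.injective (g := Φ) fun v => ?_
    exact LinearMap.congr_fun hΦΨ v
  refine ⟨LinearMap.range Ψ, LinearMap.ker Φ, ?_, ⟨(LinearEquiv.ofInjective Ψ hinj).symm.trans
    (LinearEquiv.funCongrLeft R R (Fintype.equivFin κ).symm)⟩⟩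
  have hv : ∀ v, Φ (Ψ v) = v := fun v => LinearMap.congr_fun hΦΨ v
  constructor
  · rw [Submodule.disjoint_def]
    rintro _ ⟨v, rfl⟩ hker
    rw [LinearMap.mem_ker, hv] at hker
    rw [hker, map_zero]
  · rw [codisjoint_iff, eq_top_iff]
    intro m _
    rw [← add_sub_cancel (Ψ (Φ m)) m]
    refine Submodule.add_mem_sup ⟨_, rfl⟩ ?_
    rw [LinearMap.mem_ker, map_sub, hv, sub_self]

variable [IsLocalRing R]

/-- The elements which every linear form sends into the maximal ideal. -/
def nonsplitSubmodule (R M : Type*) [CommRing R] [AddCommGroup M] [Module R M] [IsLocalRing R] :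
    Submodule R M where
  carrier := {m | ∀ φ : M →ₗ[R] R, φ m ∈ IsLocalRing.maximalIdeal R}
  zero_mem' φ := by simp
  add_mem' ha hb φ := by rw [map_add]; exact add_mem (ha φ) (hb φ)
  smul_mem' r m hm φ := by rw [map_smul]; exact Ideal.mul_mem_left _ _ (hm φ)

/-- Projecting onto the summand and reducing modulo the maximal ideal maps M onto k^a. This kills
`nonsplitSubmodule`, so the images of the x's already span k^a. -/
theorem HasFreeSummandOfRank.le_card {κ : Type*} [Fintype κ] (x : κ → M)
    (h : Submodule.span R (Set.range x) ⊔ nonsplitSubmodule R M = ⊤) {a : ℕ}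
    (ha : HasFreeSummandOfRank R M a) : a ≤ Fintype.card κ := by
  obtain ⟨P, Q, hPQ, ⟨E⟩⟩ := ha
  let k := IsLocalRing.ResidueField R
  let pr : M →ₗ[R] (Fin a → R) := E.toLinearMap ∘ₗ P.projectionOnto Q hPQ
  have hpr : Function.Surjective pr :=
    E.surjective.comp (Submodule.projectionOnto_surjective hPQ)
  let res : (Fin a → R) →ₗ[R] (Fin a → k) :=
    LinearMap.compLeft (Algebra.linearMap R k) (Fin a)
  have hres : Function.Surjective res := fun v => by
    choose w hw using fun i => IsLocalRing.residue_surjective (v i)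
    exact ⟨w, funext hw⟩
  let f := res ∘ₗ pr
  have hf : Function.Surjective f := hres.comp hpr
  have hker : nonsplitSubmodule R M ≤ LinearMap.ker f := fun m hm => by
    rw [LinearMap.mem_ker]
    funext i
    exact (IsLocalRing.residue_eq_zero_iff _).2 (hm (LinearMap.proj i ∘ₗ pr))
  have hspan : Submodule.span R (Set.range (f ∘ x)) = ⊤ := by
    rw [Set.range_comp, Submodule.span_image, ← LinearMap.range_eq_top.2 hf,
      LinearMap.range_eq_map, ← h, Submodule.map_sup,
      LinearMap.le_ker_iff_map.1 hker, sup_bot_eq]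
  have hspan' : Submodule.span k (Set.range (f ∘ x)) = ⊤ := by
    rw [eq_top_iff]
    intro v _
    have : v ∈ Submodule.span R (Set.range (f ∘ x)) := hspan ▸ Submodule.mem_top
    exact Submodule.span_le_restrictScalars R k _ this
  calc a = Module.finrank k (Fin a → k) := by simp
    _ = (Set.range (f ∘ x)).finrank k := by
        rw [Set.finrank, hspan', finrank_top]
    _ ≤ Fintype.card κ := finrank_range_le_card _

end FreeSummand

/-! ### Linear forms on the Frobenius pushforward of a hypersurface -/

/-- The class in `F_*^e(T ⧸ I)` of an element of `T`. -/
def FrobeniusPushforward.quotientMk (p e : ℕ) {T : Type*} [CommRing T] (I : Ideal T) :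
    T →+ FrobeniusPushforward p e (T ⧸ I) :=
  (Ideal.Quotient.mk I : T →+ T ⧸ I)

namespace FrobeniusPushforward

variable (p e : ℕ) {T : Type*} [CommRing T] (I : Ideal T)

theorem quotientMk_surjective : Function.Surjective (quotientMk p e I) :=
  Ideal.Quotient.mk_surjective

theorem mk_smul_quotientMk [ExpChar (T ⧸ I) p] (r t : T) :
    Ideal.Quotient.mk I r • quotientMk p e I t = quotientMk p e I (r ^ p ^ e * t) := by
  change Ideal.Quotient.mk I r ^ p ^ e * Ideal.Quotient.mk I t = Ideal.Quotient.mk I _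
  rw [map_mul, map_pow]

theorem quotientMk_eq_iff {t t' : T} : quotientMk p e I t = quotientMk p e I t' ↔ t - t' ∈ I :=
  Ideal.Quotient.eq

end FrobeniusPushforward

open FrobeniusPushforward

/-- A `q`-th root linear map on `T` induces one on `T ⧸ (g)` after multiplication by any `h` with
`g ^ q ∣ h * g`. -/
theorem exists_linearMap_quotient_span_singleton (p e : ℕ) {T : Type*} [CommRing T] (g h : T)
    [ExpChar (T ⧸ (Ideal.span {g} : Ideal T)) p] (ψ : T →+ T)
    (hψ : ∀ r s, ψ (r ^ p ^ e * s) = r * ψ s) (hg : g ^ p ^ e ∣ h * g) :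
    ∃ φ : FrobeniusPushforward p e (T ⧸ (Ideal.span {g} : Ideal T))
        →ₗ[T ⧸ (Ideal.span {g} : Ideal T)] (T ⧸ (Ideal.span {g} : Ideal T)),
      ∀ t : T, φ (quotientMk p e (Ideal.span {g}) t) =
         Ideal.Quotient.mk (Ideal.span {g}) (ψ (h * t)) := by
  let I : Ideal T := Ideal.span {g}
  have hwd : ∀ t t' : T, Ideal.Quotient.mk I t = Ideal.Quotient.mk I t' →
      Ideal.Quotient.mk I (ψ (h * t)) = Ideal.Quotient.mk I (ψ (h * t')) := by
    intro t t' htt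
    rw [Ideal.Quotient.eq, Ideal.mem_span_singleton'] at htt
    obtain ⟨s, hs⟩ := htt
    obtain ⟨w, hw⟩ := hg
    -- Changing t by s g changes h t by a multiple of g^q, hence its image under ψ by a multiple of
    -- g.
    have : h * t = h * t' + g ^ p ^ e * (w * s) := by
      linear_combination (-h) * hs + s * hw
    rw [this, map_add, hψ, Ideal.Quotient.eq, add_sub_cancel_left]
    exact Ideal.mul_mem_right _ _ (Ideal.mem_span_singleton_self g)
  have hsurj : Function.Surjective (Ideal.Quotient.mk I) := Ideal.Quotient.mk_surjective
  let F : (T ⧸ I) → (T ⧸ I) := fun r =>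
    Ideal.Quotient.mk I (ψ (h * Function.surjInv hsurj r))
  have hF : ∀ t, F (Ideal.Quotient.mk I t) = Ideal.Quotient.mk I (ψ (h * t)) := fun t =>
    hwd _ _ (Function.surjInv_eq hsurj _)
  refine ⟨⟨⟨F, ?_⟩, ?_⟩, hF⟩
  · intro x y
    obtain ⟨s, rfl⟩ := hsurj x
    obtain ⟨t, rfl⟩ := hsurj y
    change F (Ideal.Quotient.mk I s + Ideal.Quotient.mk I t) = F _ + F _
    rw [← map_add, hF, hF, hF, mul_add, map_add, map_add]
  · intro r y
    obtain ⟨s, rfl⟩ := hsurj r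
    obtain ⟨t, rfl⟩ := hsurj y
    change F (Ideal.Quotient.mk I s ^ p ^ e * Ideal.Quotient.mk I t) =
      Ideal.Quotient.mk I s * F (Ideal.Quotient.mk I t)
    rw [← map_pow, ← map_mul, hF, hF, ← map_mul, ← hψ, mul_left_comm]

/-- The product telescopes to y^q - x^q, which is (y - x)^q in characteristic p. The geometric sum
serves as the multiplier h for g = y - x. -/
theorem dvd_geom_sum₂_mul_sub (p e : ℕ) {T : Type*} [CommRing T] [ExpChar T p] (x y : T) :
    (y - x) ^ p ^ e ∣
      (∑ i ∈ Finset.range (p ^ e), x ^ i * y ^ (p ^ e - 1 - i)) * (y - x) := by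
  have := geom_sum₂_mul x y (p ^ e)
  rw [sub_pow_expChar_pow]
  exact ⟨1, by linear_combination -this⟩

theorem IsFrobeniusBasis.span_quotientMk_eq_top {p e : ℕ} {ι T : Type*} [Fintype ι] [CommRing T]
    (I : Ideal T) [ExpChar (T ⧸ I) p] {b : ι → T} {π : ι → T →+ T}
    (h : IsFrobeniusBasis (p ^ e) b π) :
    Submodule.span (T ⧸ I) (Set.range fun i => quotientMk p e I (b i)) = ⊤ := by
  rw [eq_top_iff]
  rintro x -
  obtain ⟨t, rfl⟩ := quotientMk_surjective p e I x
  rw [← h.sum_coord t, map_sum]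
  simp_rw [← mk_smul_quotientMk]
  exact Submodule.sum_mem _ fun i _ => Submodule.smul_mem _ _ (Submodule.subset_span ⟨i, rfl⟩)

theorem MvPowerSeries.decimate_monomial_of_eq_zero {σ A : Type*} [CommRing A] (q : ℕ) {π : A →+ A}
    (α γ : σ →₀ ℕ) {c : A} (h : π c = 0) : decimate q α π (monomial γ c) = 0 := by
  classical
  ext β
  rw [coeff_decimate, coeff_monomial]
  split_ifs <;> simp [h]

instance MvPowerSeries.instExpChar (σ A : Type*) [CommRing A] (p : ℕ) [ExpChar A p] :
    ExpChar (MvPowerSeries σ A) p :=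
  expChar_of_injective_ringHom (f := MvPowerSeries.C (σ := σ) (R := A))
    (MvPowerSeries.C_injective) p

theorem MvPowerSeries.X_ne_zero_of_field {σ K : Type*} [Field K] (t : σ) :
    (X t : MvPowerSeries σ K) ≠ 0 := fun h => by
  simpa using congrArg (coeff (Finsupp.single t 1)) h

theorem Finsupp.equivFunOnFinite_symm_zero' {σ : Type*} [Finite σ] :
    Finsupp.equivFunOnFinite.symm (0 : σ → ℕ) = 0 := by ext; simp

theorem Finsupp.equivFunOnFinite_symm_add {σ : Type*} [Finite σ] (a b : σ → ℕ) :
    Finsupp.equivFunOnFinite.symm (a + b) =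
      Finsupp.equivFunOnFinite.symm a + Finsupp.equivFunOnFinite.symm b := by ext; simp

/-! ### Monomials and coordinate forms on the double suspension -/

section DoubleSuspension

open MvPowerSeries

variable {K : Type*} [Field K] {n : ℕ}

/-- The monomial `l x^a u^{b 0} v^{b 1}` of `K[[x]][[u, v]]`. -/
noncomputable def bimonomial (l : K) (a : Fin n → ℕ) (b : Fin 2 → ℕ) :
    MvPowerSeries (Fin 2) (MvPowerSeries (Fin n) K) :=
  monomial (Finsupp.equivFunOnFinite.symm b) (monomial (Finsupp.equivFunOnFinite.symm a) l)

theorem bimonomial_mul (l l' : K) (a a' : Fin n → ℕ) (b b' : Fin 2 → ℕ) :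
    bimonomial l a b * bimonomial l' a' b' = bimonomial (l * l') (a + a') (b + b') := by
  rw [bimonomial, bimonomial, bimonomial, monomial_mul_monomial, monomial_mul_monomial,
    Finsupp.equivFunOnFinite_symm_add, Finsupp.equivFunOnFinite_symm_add]

theorem bimonomial_one_zero_zero : (bimonomial 1 0 0 :
    MvPowerSeries (Fin 2) (MvPowerSeries (Fin n) K)) = 1 := by
  rw [bimonomial, Finsupp.equivFunOnFinite_symm_zero', Finsupp.equivFunOnFinite_symm_zero', monomial_zero_one, monomial_zero_one]

theorem bimonomial_one_pow (a : Fin n → ℕ) (b : Fin 2 → ℕ) (k : ℕ) :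
    (bimonomial 1 a b : MvPowerSeries (Fin 2) (MvPowerSeries (Fin n) K)) ^ k =
      bimonomial 1 (k • a) (k • b) := by
  induction k with
  | zero => simp [bimonomial_one_zero_zero]
  | succ k ih => rw [pow_succ, ih, bimonomial_mul, one_mul, succ_nsmul, succ_nsmul]

theorem X_eq_bimonomial (t : Fin 2) :
    (X t : MvPowerSeries (Fin 2) (MvPowerSeries (Fin n) K)) = bimonomial 1 0 (Pi.single t 1) := by
  rw [bimonomial, Finsupp.equivFunOnFinite_symm_zero', monomial_zero_one, X, Finsupp.equivFunOnFinite_symm_single]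

theorem C_X_eq_bimonomial (j : Fin n) :
    (C (X j) : MvPowerSeries (Fin 2) (MvPowerSeries (Fin n) K)) =
      bimonomial 1 (Pi.single j 1) 0 := by
  rw [bimonomial, Finsupp.equivFunOnFinite_symm_zero', monomial_zero_eq_C_apply, Finsupp.equivFunOnFinite_symm_single, X]

theorem powerSeriesMonomial_eq_monomial (D : Fin n → ℕ) :
    powerSeriesMonomial K D = monomial (Finsupp.equivFunOnFinite.symm D) 1 := by
  rw [powerSeriesMonomial, monomial_eq', map_one, one_mul, Finsupp.prod_fintype _ _ (by simp)]
  rfl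

theorem C_powerSeriesMonomial (D : Fin n → ℕ) :
    (C (powerSeriesMonomial K D) : MvPowerSeries (Fin 2) (MvPowerSeries (Fin n) K)) =
      bimonomial 1 D 0 := by
  rw [bimonomial, Finsupp.equivFunOnFinite_symm_zero', monomial_zero_eq_C_apply, powerSeriesMonomial_eq_monomial]

theorem X_mul_X_eq_bimonomial :
    (X 0 * X 1 : MvPowerSeries (Fin 2) (MvPowerSeries (Fin n) K)) = bimonomial 1 0 1 := by
  rw [X_eq_bimonomial, X_eq_bimonomial, bimonomial_mul, one_mul, add_zero]
  congr 1
  ext t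
  fin_cases t <;> simp

/-- The equation `f + u v` of the double suspension of `f = x^D`. -/
noncomputable abbrev suspensionEquation (K : Type*) [Field K] (D : Fin n → ℕ) :
    MvPowerSeries (Fin 2) (MvPowerSeries (Fin n) K) :=
  C (powerSeriesMonomial K D) + X 0 * X 1

theorem suspensionEquation_eq (D : Fin n → ℕ) :
    suspensionEquation K D = bimonomial 1 D 0 + bimonomial 1 0 1 := by
  rw [suspensionEquation, C_powerSeriesMonomial, X_mul_X_eq_bimonomial]

/-- The ideal `(f + u v)`. -/
noncomputable abbrev suspensionIdeal (K : Type*) [Field K] (D : Fin n → ℕ) :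
    Ideal (MvPowerSeries (Fin 2) (MvPowerSeries (Fin n) K)) :=
  Ideal.span {suspensionEquation K D}

variable (D : Fin n → ℕ)

/-- The relation uv = -f trades each factor uv for -x^D. -/
theorem quotientMk_bimonomial_add (p e : ℕ) (l : K) (a : Fin n → ℕ) (b : Fin 2 → ℕ) (k : ℕ) :
    quotientMk p e (suspensionIdeal K D) (bimonomial l a (b + k • 1)) =
      quotientMk p e (suspensionIdeal K D) ((-1) ^ k * bimonomial l (a + k • D) b) := by
  induction k generalizing b with
  | zero => simp
  | succ k ih =>
    rw [succ_nsmul', ← add_assoc, ih, quotientMk_eq_iff, Ideal.mem_span_singleton]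
    refine ⟨(-1) ^ k * bimonomial l (a + k • D) b, ?_⟩
    have h1 : bimonomial l (a + k • D) (b + 1) = bimonomial 1 0 1 * bimonomial l (a + k • D) b := by
      rw [bimonomial_mul, one_mul, zero_add, add_comm b]
    have h2 : bimonomial l (a + (k + 1) • D) b = bimonomial 1 D 0 * bimonomial l (a + k • D) b := by
      rw [bimonomial_mul, one_mul, zero_add, succ_nsmul, ← add_assoc, add_comm D]
    rw [h1, h2, suspensionEquation_eq]
    ring

/-- The coordinate function on `K[[x]][[u, v]]` that belongs to a basis element of `K` over
`q`-th powers and to the monomial `x^α u^{β 0} v^{β 1}`. -/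
noncomputable def bicoord (q : ℕ) (π : K →+ K) (α : Fin n → ℕ) (β : Fin 2 → ℕ) :
    MvPowerSeries (Fin 2) (MvPowerSeries (Fin n) K) →+
      MvPowerSeries (Fin 2) (MvPowerSeries (Fin n) K) :=
  decimate q (Finsupp.equivFunOnFinite.symm β) (decimate q (Finsupp.equivFunOnFinite.symm α) π)

theorem bicoord_pow_mul (p e : ℕ) [ExpChar K p] {π : K →+ K}
    (hπ : ∀ r s, π (r ^ p ^ e * s) = r * π s) {α : Fin n → ℕ} {β : Fin 2 → ℕ}
    (hα : ∀ j, α j < p ^ e) (hβ : ∀ t, β t < p ^ e)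
    (r s : MvPowerSeries (Fin 2) (MvPowerSeries (Fin n) K)) :
    bicoord (p ^ e) π α β (r ^ p ^ e * s) = r * bicoord (p ^ e) π α β s :=
  decimate_pow_mul p e (decimate_pow_mul p e hπ hα) hβ r s

theorem bicoord_bimonomial_self {q : ℕ} (hq : 0 < q) {π : K →+ K} {l : K} (hl : π l = 1)
    (α : Fin n → ℕ) (β : Fin 2 → ℕ) : bicoord q π α β (bimonomial l α β) = 1 := by
  rw [bicoord, bimonomial, decimate_monomial_self hq, decimate_monomial_self hq, hl, map_one,
    map_one]

theorem bicoord_bimonomial_of_eq_zero (q : ℕ) {π : K →+ K} {l : K} (hl : π l = 0)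
    (α a : Fin n → ℕ) (β b : Fin 2 → ℕ) : bicoord q π α β (bimonomial l a b) = 0 :=
  decimate_monomial_of_eq_zero _ _ _ (decimate_monomial_of_eq_zero _ _ _ hl)

theorem bicoord_bimonomial_of_not_modEq (q : ℕ) (π : K →+ K) (l : K)
    {α a : Fin n → ℕ} {β b : Fin 2 → ℕ}
    (h : ¬ ((∀ j, a j ≡ α j [MOD q]) ∧ ∀ t, b t ≡ β t [MOD q])) :
    bicoord q π α β (bimonomial l a b) = 0 := by
  rw [not_and_or, not_forall, not_forall] at h
  rcases h with ⟨j, hj⟩ | ⟨t, ht⟩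
  · exact decimate_monomial_of_eq_zero _ _ _ (decimate_monomial_of_not_modEq (i := j) _ _ hj _)
  · exact decimate_monomial_of_not_modEq (i := t) _ _ ht _

/-- The multiplier is the geometric sum with x = -f and y = uv; the index i records the power of -f.
-/
theorem exists_linearMap_bicoord (p e : ℕ) [ExpChar K p]
    [ExpChar (DoubleSuspension (MvPowerSeries (Fin n) K) (powerSeriesMonomial K D)) p]
    {π : K →+ K} (hπ : ∀ r s, π (r ^ p ^ e * s) = r * π s) {α : Fin n → ℕ} {β : Fin 2 → ℕ}
    (hα : ∀ j, α j < p ^ e) (hβ : ∀ t, β t < p ^ e) :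
    ∃ φ : FrobeniusPushforward p e
          (DoubleSuspension (MvPowerSeries (Fin n) K) (powerSeriesMonomial K D))
        →ₗ[DoubleSuspension (MvPowerSeries (Fin n) K) (powerSeriesMonomial K D)]
          (DoubleSuspension (MvPowerSeries (Fin n) K) (powerSeriesMonomial K D)),
      ∀ l a b, φ (quotientMk p e (suspensionIdeal K D) (bimonomial l a b)) =
        ∑ i ∈ Finset.range (p ^ e), Ideal.Quotient.mk (suspensionIdeal K D) ((-1) ^ i *
          bicoord (p ^ e) π α β (bimonomial l (a + i • D) (b + (p ^ e - 1 - i) • 1))) := by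
  let x : MvPowerSeries (Fin 2) (MvPowerSeries (Fin n) K) := - bimonomial 1 D 0
  let y : MvPowerSeries (Fin 2) (MvPowerSeries (Fin n) K) := bimonomial 1 0 1
  have hyx : y - x = suspensionEquation K D := by
    rw [suspensionEquation_eq]; simp only [x, y]; ring
  have hdvd := dvd_geom_sum₂_mul_sub p e x y
  rw [hyx] at hdvd
  obtain ⟨φ, hφ⟩ := exists_linearMap_quotient_span_singleton p e (suspensionEquation K D) _
    (bicoord (p ^ e) π α β) (bicoord_pow_mul p e hπ hα hβ) hdvd
  refine ⟨φ, fun l a b => ?_⟩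
  rw [hφ, Finset.sum_mul, map_sum, map_sum]
  refine Finset.sum_congr rfl fun i _ => ?_
  have h1 : x ^ i * y ^ (p ^ e - 1 - i) * bimonomial l a b =
      (-1) ^ i * bimonomial l (a + i • D) (b + (p ^ e - 1 - i) • 1) := by
    simp only [x, y]
    rw [neg_pow, bimonomial_one_pow, bimonomial_one_pow, mul_assoc, mul_assoc, bimonomial_mul,
      bimonomial_mul, one_mul, one_mul, smul_zero, smul_zero, zero_add, zero_add, add_comm a,
      add_comm b]
  rw [h1]
  rcases Nat.even_or_odd i with h | h
  · rw [h.neg_one_pow, one_mul, one_mul]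
  · rw [h.neg_one_pow, neg_one_mul, map_neg, neg_one_mul]

end DoubleSuspension

/-! ### Index set of the free generators -/

/-- For `c ∈ ℤ`, the exponents of `u` and `v` in the monomial `u^c` (`c ≥ 0`) or `v^{-c}`. -/
def splitExp (c : ℤ) : Fin 2 → ℕ := ![c.toNat, (-c).toNat]

/-- The pairs `(c, a)` for which `x^a u^c` (or `x^a v^{-c}`) spans a free summand. -/
noncomputable def freeIndex {n : ℕ} (D : Fin n → ℕ) (q : ℕ) : Finset (Σ _ : ℤ, Fin n → ℕ) :=
  (Finset.Ioo (-(q : ℤ)) q).sigma fun c =>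
    Fintype.piFinset fun j => Finset.range (q - D j * c.natAbs)

theorem mem_freeIndex {n : ℕ} {D : Fin n → ℕ} {q : ℕ} {z : Σ _ : ℤ, Fin n → ℕ} :
    z ∈ freeIndex D q ↔ (-(q : ℤ) < z.1 ∧ z.1 < q) ∧ ∀ j, z.2 j + z.1.natAbs * D j < q := by
  simp only [freeIndex, Finset.mem_sigma, Finset.mem_Ioo, Fintype.mem_piFinset, Finset.mem_range]
  refine and_congr_right fun _ => forall_congr' fun j => ?_
  rw [mul_comm (D j)]
  omega

/-- This is the orthogonality of the dual forms: the i-th term of the form for (c, a) can meet the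
generator (c', a') only when the two agree and i = |c|. With c⁺, c⁻ the positive and negative parts,
the first two congruences say that i ≡ c'⁺ + c⁻ and i ≡ c'⁻ + c⁺ modulo q, and the size bounds leave
two values for each quotient. -/
theorem eq_of_exponents_modEq {q : ℕ} {c c' : ℤ} {i d a a' : ℕ} (hd : 1 ≤ d) (hi : i < q)
    (ha : a + c.natAbs * d < q) (ha' : a' + c'.natAbs * d < q)
    (h0 : c'.toNat + (q - 1 - i) ≡ q - 1 - (-c).toNat [MOD q])
    (h1 : (-c').toNat + (q - 1 - i) ≡ q - 1 - c.toNat [MOD q])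
    (h2 : a' + i * d ≡ a + c.natAbs * d [MOD q]) : c' = c ∧ i = c.natAbs ∧ a' = a := by
  have hc : c.natAbs < q := by nlinarith
  have hc' : c'.natAbs < q := by nlinarith
  obtain ⟨k₁, hk₁⟩ := Nat.modEq_iff_dvd.1 h0
  obtain ⟨k₂, hk₂⟩ := Nat.modEq_iff_dvd.1 h1
  have e1 : (i : ℤ) - c'.toNat - (-c).toNat = q * k₁ := by
    rw [← hk₁]; push_cast; omega
  have e2 : (i : ℤ) - (-c').toNat - c.toNat = q * k₂ := by
    rw [← hk₂]; push_cast; omega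
  have : (c'.toNat : ℤ) + (-c').toNat < q ∧ (c.toNat : ℤ) + (-c).toNat < q := by omega
  have b1 : k₁ = 0 ∨ k₁ = -1 := by
    have : k₁ < 1 := by by_contra hk; push Not at hk; nlinarith
    have : -2 < k₁ := by by_contra hk; push Not at hk; nlinarith
    omega
  have b2 : k₂ = 0 ∨ k₂ = -1 := by
    have : k₂ < 1 := by by_contra hk; push Not at hk; nlinarith
    have : -2 < k₂ := by by_contra hk; push Not at hk; nlinarith
    omega
  -- When the quotients differ, i = 0 and |c| + |c'| = q. Then a' = a + |c| d, so a' + |c'| d = a +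
  -- q d ≥ q, a contradiction.
  have key : ∀ (_ : i = 0) (_ : c.natAbs + c'.natAbs = q), False := by
    rintro rfl hq
    rw [zero_mul, add_zero] at h2
    have := h2.eq_of_lt_of_lt (by omega) ha
    have h3 : (c.natAbs + c'.natAbs) * d = q * d := by rw [hq]
    nlinarith
  rcases b1 with rfl | rfl <;> rcases b2 with rfl | rfl
  · have hcc : c' = c := by omega
    have hic : i = c.natAbs := by omega
    refine ⟨hcc, hic, ?_⟩
    subst hcc hic
    exact h2.add_right_cancel'.eq_of_lt_of_lt (by omega) (by omega)
  · exact (key (by omega) (by omega)).elim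
  · exact (key (by omega) (by omega)).elim
  · omega

/-! ### The maximal free rank of the double suspension -/

section DoubleSuspension

open MvPowerSeries

variable {K : Type*} [Field K] {n : ℕ} {D : Fin n → ℕ}

theorem constantCoeff_powerSeriesMonomial (hn : 1 ≤ n) (hD : ∀ j, 1 ≤ D j) :
    constantCoeff (powerSeriesMonomial K D) = 0 := by
  rw [powerSeriesMonomial, map_prod]
  refine Finset.prod_eq_zero (Finset.mem_univ ⟨0, hn⟩) ?_
  rw [map_pow, constantCoeff_X, zero_pow]
  have := hD ⟨0, hn⟩
  omega

/-- Setting x = 0 would put u or v in the ideal (uv) of K[[u,v]]. -/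
theorem not_mk_C_X_dvd_mk_X (hn : 1 ≤ n) (hD : ∀ j, 1 ≤ D j) (j : Fin n) (t : Fin 2) :
    ¬ Ideal.Quotient.mk (suspensionIdeal K D) (C (X j)) ∣
      Ideal.Quotient.mk (suspensionIdeal K D) (X t) := by
  rintro ⟨r, hr⟩
  obtain ⟨r, rfl⟩ := Ideal.Quotient.mk_surjective r
  rw [← map_mul, Ideal.Quotient.eq, Ideal.mem_span_singleton] at hr
  obtain ⟨w, hw⟩ := hr
  have h := congrArg (MvPowerSeries.map (σ := Fin 2) (constantCoeff (σ := Fin n) (R := K))) hw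
  simp only [suspensionEquation, map_sub, map_mul, map_add, map_X, map_C, constantCoeff_X, map_zero,
    zero_mul, sub_zero, constantCoeff_powerSeriesMonomial hn hD, zero_add] at h
  obtain ⟨t', ht'⟩ : ∃ t' : Fin 2, (X 0 * X 1 : MvPowerSeries (Fin 2) K) = X t * X t' := by
    fin_cases t
    · exact ⟨1, rfl⟩
    · exact ⟨0, mul_comm _ _⟩
  rw [ht', mul_assoc] at h
  have h1 := mul_left_cancel₀ (MvPowerSeries.X_ne_zero_of_field t) ((mul_one _).trans h)
  have h2 := congrArg (constantCoeff (σ := Fin 2) (R := K)) h1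
  simp at h2

variable {p e : ℕ}
  [ExpChar (DoubleSuspension (MvPowerSeries (Fin n) K) (powerSeriesMonomial K D)) p]

theorem hasFreeSummandOfRank_suspension [ExpChar K p] (hn : 1 ≤ n) (hD : ∀ j, 1 ≤ D j)
    {ι : Type*} [Fintype ι] {b : ι → K} {π : ι → K →+ K} (hb : IsFrobeniusBasis (p ^ e) b π) :
    HasFreeSummandOfRank (DoubleSuspension (MvPowerSeries (Fin n) K) (powerSeriesMonomial K D))
      (FrobeniusPushforward p e
        (DoubleSuspension (MvPowerSeries (Fin n) K) (powerSeriesMonomial K D)))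
      (Fintype.card ι * (freeIndex D (p ^ e)).card) := by
  classical
  have hq : 0 < p ^ e := pow_pos (expChar_pos K p) e
  have hmem := fun k : ι × freeIndex D (p ^ e) => mem_freeIndex.1 k.2.2
  have hα : ∀ (k : ι × freeIndex D (p ^ e)) j,
      (k.2.1.2 + k.2.1.1.natAbs • D) j < p ^ e := fun k j => by simpa using (hmem k).2 j
  -- These are the exponents of u and v in the term i = |c| of h times the generator, namely
  -- `splitExp c` plus q - 1 - |c| in both places.
  have hβ : ∀ (k : ι × freeIndex D (p ^ e)) t,
      (![p ^ e - 1 - (-k.2.1.1).toNat, p ^ e - 1 - k.2.1.1.toNat] : Fin 2 → ℕ) t < p ^ e :=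
    fun k t => by fin_cases t <;> simp <;> omega
  choose φ hφ using fun k : ι × freeIndex D (p ^ e) =>
    exists_linearMap_bicoord D p e (hb.coord_pow_mul k.1) (hα k) (hβ k)
  have key := hasFreeSummandOfRank_of_dual
    (fun k : ι × freeIndex D (p ^ e) => quotientMk p e (suspensionIdeal K D)
      (bimonomial (b k.1) k.2.1.2 (splitExp k.2.1.1)))
    -- The factor cancels the sign (-1)^|c| of the only surviving term, i = |c|.
    (fun k => Ideal.Quotient.mk (suspensionIdeal K D) ((-1) ^ k.2.1.1.natAbs) • φ k) ?_
  · rwa [Fintype.card_prod, Fintype.card_coe] at key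
  intro k k'
  rw [LinearMap.smul_apply, hφ, smul_eq_mul]
  by_cases hl : k.1 = k'.1
  swap
  · rw [if_neg (fun h => hl (congrArg Prod.fst h)), Finset.sum_eq_zero, mul_zero]
    intro i _
    rw [bicoord_bimonomial_of_eq_zero _ (hb.coord_of_ne _ _ hl), mul_zero, map_zero]
  have hzero : ∀ i ∈ Finset.range (p ^ e), ¬ (k'.2.1 = k.2.1 ∧ i = k.2.1.1.natAbs) →
      bicoord (p ^ e) (π k.1) (k.2.1.2 + k.2.1.1.natAbs • D)
        ![p ^ e - 1 - (-k.2.1.1).toNat, p ^ e - 1 - k.2.1.1.toNat]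
        (bimonomial (b k'.1) (k'.2.1.2 + i • D)
          (splitExp k'.2.1.1 + (p ^ e - 1 - i) • 1)) = 0 := by
    intro i hi hne
    refine bicoord_bimonomial_of_not_modEq _ _ _ fun hmod => hne ?_
    have hj := fun j => eq_of_exponents_modEq (hD j) (Finset.mem_range.1 hi) ((hmem k).2 j)
      ((hmem k').2 j) (by simpa [splitExp] using hmod.2 0) (by simpa [splitExp] using hmod.2 1)
      (by simpa using hmod.1 j)
    exact ⟨Sigma.ext (hj ⟨0, hn⟩).1 (heq_of_eq (funext fun j => (hj j).2.2)), (hj ⟨0, hn⟩).2.1⟩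
  by_cases hz : k'.2.1 = k.2.1
  · have hkk : k = k' := Prod.ext hl (Subtype.ext hz.symm)
    subst hkk
    have hc := (hmem k).1
    rw [if_pos rfl, Finset.sum_eq_single k.2.1.1.natAbs]
    · have hexp : splitExp k.2.1.1 + (p ^ e - 1 - k.2.1.1.natAbs) • 1 =
          ![p ^ e - 1 - (-k.2.1.1).toNat, p ^ e - 1 - k.2.1.1.toNat] := by
        ext t
        fin_cases t <;> simp [splitExp] <;> omega
      rw [hexp, bicoord_bimonomial_self hq (hb.coord_self _), mul_one, ← map_mul, ← mul_pow,
        neg_one_mul, neg_neg, one_pow, map_one]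
    · intro i hi hne
      rw [hzero i hi (fun h => hne h.2), mul_zero, map_zero]
    · intro h
      exact (h (Finset.mem_range.2 (by omega))).elim
  · rw [if_neg (fun h => hz (by rw [h])), Finset.sum_eq_zero, mul_zero]
    intro i hi
    rw [hzero i hi (fun h => hz h.1), mul_zero, map_zero]

variable (p e)
  [IsLocalRing (DoubleSuspension (MvPowerSeries (Fin n) K) (powerSeriesMonomial K D))]

/-- Multiplying by u or v in F_*^e(R) creates a factor (uv)^k, which becomes ± f^k and supplies
x_j^q. So u φ(m) or v φ(m) is a multiple of x_j, impossible if φ(m) is a unit. -/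
theorem quotientMk_bimonomial_mem_nonsplitSubmodule_of_eq (hn : 1 ≤ n) (hD : ∀ j, 1 ≤ D j) (l : K)
    {a : Fin n → ℕ} {b b' : Fin 2 → ℕ} {k : ℕ} (t : Fin 2) (j : Fin n)
    (hb : b + p ^ e • Pi.single t 1 = b' + k • 1) (ha : p ^ e ≤ a j + k * D j) :
    quotientMk p e (suspensionIdeal K D) (bimonomial l a b) ∈
      nonsplitSubmodule (DoubleSuspension (MvPowerSeries (Fin n) K) (powerSeriesMonomial K D))
        (FrobeniusPushforward p e
          (DoubleSuspension (MvPowerSeries (Fin n) K) (powerSeriesMonomial K D))) := by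
  intro φ
  rw [IsLocalRing.mem_maximalIdeal, mem_nonunits_iff]
  intro hu
  apply not_mk_C_X_dvd_mk_X (K := K) hn hD j t
  rw [← hu.dvd_mul_right]
  have h1 : Ideal.Quotient.mk (suspensionIdeal K D) (X t) •
      quotientMk p e (suspensionIdeal K D) (bimonomial l a b) =
      Ideal.Quotient.mk (suspensionIdeal K D) (C (X j)) •
        quotientMk p e (suspensionIdeal K D)
          ((-1) ^ k * bimonomial l (a + k • D - p ^ e • Pi.single j 1) b') := by
    rw [mk_smul_quotientMk, mk_smul_quotientMk, X_eq_bimonomial, bimonomial_one_pow,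
      bimonomial_mul, one_mul, smul_zero, zero_add, add_comm _ b, hb, quotientMk_bimonomial_add,
      C_X_eq_bimonomial, bimonomial_one_pow, mul_left_comm, bimonomial_mul, one_mul, smul_zero,
      zero_add, add_tsub_cancel_of_le]
    intro i
    by_cases hij : i = j
    · subst hij; simpa using ha
    · simp [hij]
  have h2 := congrArg φ h1
  rw [map_smul, map_smul, smul_eq_mul, smul_eq_mul] at h2
  exact ⟨_, h2⟩

theorem quotientMk_bimonomial_splitExp_mem_nonsplitSubmodule (hn : 1 ≤ n) (hD : ∀ j, 1 ≤ D j)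
    (l : K) {a : Fin n → ℕ} {c : ℤ} (hc : -(p ^ e : ℕ) < c ∧ c < (p ^ e : ℕ)) (j : Fin n)
    (ha : p ^ e ≤ a j + c.natAbs * D j) :
    quotientMk p e (suspensionIdeal K D) (bimonomial l a (splitExp c)) ∈
      nonsplitSubmodule (DoubleSuspension (MvPowerSeries (Fin n) K) (powerSeriesMonomial K D))
        (FrobeniusPushforward p e
          (DoubleSuspension (MvPowerSeries (Fin n) K) (powerSeriesMonomial K D))) := by
  rcases le_total 0 c with h0 | h0
  -- For c ≥ 0, u^c v^q = (uv)^c v^(q-c); the other case exchanges u and v.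
  · refine quotientMk_bimonomial_mem_nonsplitSubmodule_of_eq p e hn hD l
      (b' := ![0, p ^ e - c.natAbs]) 1 j ?_ ha
    ext t
    fin_cases t <;> simp [splitExp] <;> omega
  · refine quotientMk_bimonomial_mem_nonsplitSubmodule_of_eq p e hn hD l
      (b' := ![p ^ e - c.natAbs, 0]) 0 j ?_ ha
    ext t
    fin_cases t <;> simp [splitExp] <;> omega

variable {p e}

theorem span_sup_nonsplitSubmodule_eq_top [ExpChar K p] (hn : 1 ≤ n) (hD : ∀ j, 1 ≤ D j)
    {ι : Type*} [Fintype ι] {b : ι → K} {π : ι → K →+ K} (hb : IsFrobeniusBasis (p ^ e) b π) :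
    Submodule.span (DoubleSuspension (MvPowerSeries (Fin n) K) (powerSeriesMonomial K D))
        (Set.range fun k : ι × freeIndex D (p ^ e) => quotientMk p e (suspensionIdeal K D)
          (bimonomial (b k.1) k.2.1.2 (splitExp k.2.1.1))) ⊔
      nonsplitSubmodule (DoubleSuspension (MvPowerSeries (Fin n) K) (powerSeriesMonomial K D))
        (FrobeniusPushforward p e
          (DoubleSuspension (MvPowerSeries (Fin n) K) (powerSeriesMonomial K D))) = ⊤ := by
  rw [eq_top_iff, ← (hb.mvPowerSeries (σ := Fin n)).mvPowerSeries (σ := Fin 2)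
    |>.span_quotientMk_eq_top (suspensionIdeal K D), Submodule.span_le]
  rintro _ ⟨⟨⟨l, α⟩, β⟩, rfl⟩
  -- The common factor (uv)^m is traded for ± f^m, leaving a pure power of u or of v.
  let m := min (β 0 : ℕ) (β 1)
  let c : ℤ := (β 0 : ℤ) - (β 1 : ℤ)
  have hβ : (fun t => (β t : ℕ)) = splitExp c + m • 1 := by
    ext t
    fin_cases t <;> simp [splitExp, c, m] <;> omega
  have hc : -((p ^ e : ℕ) : ℤ) < c ∧ c < (p ^ e : ℕ) := by
    have h0 := (β 0).2
    have h1 := (β 1).2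
    simp only [c]
    omega
  change quotientMk p e (suspensionIdeal K D)
    (bimonomial (b l) (fun j => (α j : ℕ)) (fun t => (β t : ℕ))) ∈ _
  rw [hβ, quotientMk_bimonomial_add]
  -- The exponent of x may now exceed q; both cases below allow this.
  generalize (fun j => (α j : ℕ)) + m • D = a
  suffices h : quotientMk p e (suspensionIdeal K D) (bimonomial (b l) a (splitExp c)) ∈
      Submodule.span (DoubleSuspension (MvPowerSeries (Fin n) K) (powerSeriesMonomial K D))
        (Set.range fun k : ι × freeIndex D (p ^ e) => quotientMk p e (suspensionIdeal K D)
          (bimonomial (b k.1) k.2.1.2 (splitExp k.2.1.1))) ⊔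
      nonsplitSubmodule (DoubleSuspension (MvPowerSeries (Fin n) K) (powerSeriesMonomial K D))
        (FrobeniusPushforward p e
          (DoubleSuspension (MvPowerSeries (Fin n) K) (powerSeriesMonomial K D))) by
    rcases Nat.even_or_odd m with hm | hm
    · rwa [hm.neg_one_pow, one_mul]
    · rw [hm.neg_one_pow, neg_one_mul, map_neg]
      exact neg_mem h
  by_cases ha : ∀ j, a j + c.natAbs * D j < p ^ e
  · refine Submodule.mem_sup_left (Submodule.subset_span ⟨(l, ⟨⟨c, a⟩, ?_⟩), rfl⟩)
    exact mem_freeIndex.2 ⟨hc, ha⟩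
  · push Not at ha
    obtain ⟨j, hj⟩ := ha
    exact Submodule.mem_sup_right
      (quotientMk_bimonomial_splitExp_mem_nonsplitSubmodule p e hn hD _ hc j hj)

theorem isMaxFreeRank_suspension [ExpChar K p] (hn : 1 ≤ n) (hD : ∀ j, 1 ≤ D j)
    {ι : Type*} [Fintype ι] {b : ι → K} {π : ι → K →+ K} (hb : IsFrobeniusBasis (p ^ e) b π) :
    IsMaxFreeRank (DoubleSuspension (MvPowerSeries (Fin n) K) (powerSeriesMonomial K D))
      (FrobeniusPushforward p e
        (DoubleSuspension (MvPowerSeries (Fin n) K) (powerSeriesMonomial K D)))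
      (Fintype.card ι * (freeIndex D (p ^ e)).card) := by
  refine ⟨hasFreeSummandOfRank_suspension hn hD hb, fun a ha => ?_⟩
  have := ha.le_card _ (span_sup_nonsplitSubmodule_eq_top hn hD hb)
  rwa [Fintype.card_prod, Fintype.card_coe] at this

end DoubleSuspension

/-! ### Krull dimension, residue field and finiteness -/

section KrullDim

/-- The variable is a nonzerodivisor in the maximal ideal, with quotient A. -/
theorem PowerSeries.ringKrullDim_of_isNoetherianRing_of_isLocalRing (A : Type*) [CommRing A]
    [IsNoetherianRing A] [IsLocalRing A] :
    ringKrullDim (PowerSeries A) = ringKrullDim A + 1 := by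
  have hX : (PowerSeries.X : PowerSeries A) ∈ IsLocalRing.maximalIdeal (PowerSeries A) := by
    rw [IsLocalRing.mem_maximalIdeal, mem_nonunits_iff, PowerSeries.isUnit_iff_constantCoeff]
    simp
  have hreg : (PowerSeries.X : PowerSeries A) ∈ nonZeroDivisors (PowerSeries A) :=
    MvPowerSeries.X_mem_nonzeroDivisors
  rw [← ringKrullDim_quotient_span_singleton_succ_eq_ringKrullDim_of_mem_nonZeroDivisors hreg hX]
  have e : (PowerSeries A ⧸ Ideal.span {(PowerSeries.X : PowerSeries A)}) ≃+* A :=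
    (Ideal.quotEquivOfEq (Ideal.ext fun f => by
      rw [Ideal.mem_span_singleton, PowerSeries.X_dvd_iff, RingHom.mem_ker])).trans
      (RingHom.quotientKerEquivOfSurjective
        (PowerSeries.constantCoeff_surj : Function.Surjective (PowerSeries.constantCoeff (R := A))))
  rw [ringKrullDim_eq_of_ringEquiv e]

theorem MvPowerSeries.ringKrullDim_fin (A : Type*) [CommRing A] [IsNoetherianRing A]
    [IsLocalRing A] (m : ℕ) : ringKrullDim (MvPowerSeries (Fin m) A) = ringKrullDim A + m := by
  induction m with
  | zero =>
    rw [ringKrullDim_eq_of_ringEquiv (isEmptyEquiv (Fin 0) A).toRingEquiv]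
    simp
  | succ m ih =>
    rw [ringKrullDim_eq_of_ringEquiv (finSuccEquiv A m).toRingEquiv,
      PowerSeries.ringKrullDim_of_isNoetherianRing_of_isLocalRing, ih, Nat.cast_succ, add_assoc]

end KrullDim

theorem frobeniusDegree_eq_of_ringEquiv (p : ℕ) {k k' : Type*} [Field k] [Field k'] [ExpChar k p]
    [ExpChar k' p] (E : k ≃+* k') : frobeniusDegree p k = frobeniusDegree p k' := by
  have h : ∀ x : (frobenius k p).fieldRange, (E : k →+* k') x ∈ (frobenius k' p).fieldRange := by
    rintro ⟨_, y, rfl⟩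
    exact ⟨E y, by simp [frobenius_def]⟩
  let i : (frobenius k p).fieldRange →+* (frobenius k' p).fieldRange :=
    ((E : k →+* k').comp (frobenius k p).fieldRange.subtype).codRestrict _ h
  have hi : Function.Bijective i := by
    refine ⟨i.injective, ?_⟩
    rintro ⟨_, y, rfl⟩
    exact ⟨⟨_, E.symm y, rfl⟩, Subtype.ext ((map_pow E _ p).trans (by simp [frobenius_def]))⟩
  exact Algebra.finrank_eq_of_equiv_equiv (RingEquiv.ofBijective i hi) E (RingHom.ext fun _ => rfl)

section DoubleSuspension

open MvPowerSeries

variable {K : Type*} [Field K] {n : ℕ} {D : Fin n → ℕ}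

theorem suspensionEquation_mem_ker (hn : 1 ≤ n) (hD : ∀ j, 1 ≤ D j) :
    suspensionEquation K D ∈ RingHom.ker ((constantCoeff (σ := Fin n) (R := K)).comp
      (constantCoeff (σ := Fin 2) (R := MvPowerSeries (Fin n) K))) := by
  simp [RingHom.mem_ker, suspensionEquation, constantCoeff_powerSeriesMonomial hn hD]

/-- The residue map of the double suspension. -/
noncomputable def suspensionConstantCoeff (hn : 1 ≤ n) (hD : ∀ j, 1 ≤ D j) :
    DoubleSuspension (MvPowerSeries (Fin n) K) (powerSeriesMonomial K D) →+* K :=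
  Ideal.Quotient.lift _ ((constantCoeff (σ := Fin n) (R := K)).comp constantCoeff) fun _ ha =>
    (RingHom.mem_ker).1 <|
    (Ideal.span_singleton_le_iff_mem _).2 (suspensionEquation_mem_ker hn hD) ha

theorem suspensionConstantCoeff_surjective (hn : 1 ≤ n) (hD : ∀ j, 1 ≤ D j) :
    Function.Surjective (suspensionConstantCoeff (K := K) hn hD) := fun x =>
  ⟨Ideal.Quotient.mk _ (C (C x)), by
    refine (Ideal.Quotient.lift_mk _ _ _).trans ?_
    simp⟩

theorem isLocalRing_suspension (hn : 1 ≤ n) (hD : ∀ j, 1 ≤ D j) :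
    IsLocalRing (DoubleSuspension (MvPowerSeries (Fin n) K) (powerSeriesMonomial K D)) :=
  have := (suspensionConstantCoeff (K := K) hn hD).domain_nontrivial
  IsLocalRing.of_surjective' _ Ideal.Quotient.mk_surjective

theorem charP_suspension (p : ℕ) [Fact p.Prime] [CharP K p] (hn : 1 ≤ n) (hD : ∀ j, 1 ≤ D j) :
    CharP (DoubleSuspension (MvPowerSeries (Fin n) K) (powerSeriesMonomial K D)) p := by
  have := (suspensionConstantCoeff (K := K) hn hD).domain_nontrivial
  refine (CharP.charP_iff_prime_eq_zero Fact.out).2 ?_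
  rw [← map_natCast ((Ideal.Quotient.mk (suspensionIdeal K D)).comp
    ((C (σ := Fin 2)).comp (C (σ := Fin n)))), CharP.cast_eq_zero, map_zero]

theorem isFFinite_suspension (p : ℕ) [Fact p.Prime] [CharP K p]
    [ExpChar (DoubleSuspension (MvPowerSeries (Fin n) K) (powerSeriesMonomial K D)) p]
    (hK : FiniteDimensional (frobenius K p).fieldRange K) :
    IsFFinite p (DoubleSuspension (MvPowerSeries (Fin n) K) (powerSeriesMonomial K D)) := by
  obtain ⟨ι, _, b, π, -, hb⟩ := exists_isFrobeniusBasis p K hK 1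
  exact ⟨Submodule.fg_def.2 ⟨_, Set.finite_range _,
    (hb.mvPowerSeries (σ := Fin n)).mvPowerSeries (σ := Fin 2)
    |>.span_quotientMk_eq_top (suspensionIdeal K D)⟩⟩

theorem frobeniusDegree_residueField_suspension (p : ℕ) [ExpChar K p] (hn : 1 ≤ n)
    (hD : ∀ j, 1 ≤ D j)
    [IsLocalRing (DoubleSuspension (MvPowerSeries (Fin n) K) (powerSeriesMonomial K D))]
    [ExpChar (IsLocalRing.ResidueField
      (DoubleSuspension (MvPowerSeries (Fin n) K) (powerSeriesMonomial K D))) p] :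
    frobeniusDegree p (IsLocalRing.ResidueField
      (DoubleSuspension (MvPowerSeries (Fin n) K) (powerSeriesMonomial K D))) =
      frobeniusDegree p K := by
  have hsurj := suspensionConstantCoeff_surjective (K := K) hn hD
  have hker : RingHom.ker (suspensionConstantCoeff (K := K) hn hD) =
      IsLocalRing.maximalIdeal _ :=
    IsLocalRing.eq_maximalIdeal (RingHom.ker_isMaximal_of_surjective _ hsurj)
  exact frobeniusDegree_eq_of_ringEquiv p ((Ideal.quotEquivOfEq hker.symm).trans
    (RingHom.quotientKerEquivOfSurjective hsurj))

theorem suspensionEquation_ne_zero (hn : 1 ≤ n) (hD : ∀ j, 1 ≤ D j) :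
    suspensionEquation K D ≠ 0 := by
  intro h
  have h' := congrArg (MvPowerSeries.map (σ := Fin 2) (constantCoeff (σ := Fin n) (R := K))) h
  simp only [suspensionEquation, map_mul, map_add, map_X, map_C, map_zero,
    constantCoeff_powerSeriesMonomial hn hD, zero_add, mul_eq_zero] at h'
  exact h'.elim (MvPowerSeries.X_ne_zero_of_field 0) (MvPowerSeries.X_ne_zero_of_field 1)

theorem ringKrullDim_suspension (hn : 1 ≤ n) (hD : ∀ j, 1 ≤ D j) :
    ringKrullDim (DoubleSuspension (MvPowerSeries (Fin n) K) (powerSeriesMonomial K D)) =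
      (n + 1 : ℕ) := by
  have hmem : suspensionEquation K D ∈ IsLocalRing.maximalIdeal
      (MvPowerSeries (Fin 2) (MvPowerSeries (Fin n) K)) := by
    rw [IsLocalRing.mem_maximalIdeal, mem_nonunits_iff]
    intro hu
    have := hu.map ((constantCoeff (σ := Fin n) (R := K)).comp
      (constantCoeff (σ := Fin 2) (R := MvPowerSeries (Fin n) K)))
    rw [(RingHom.mem_ker).1 (suspensionEquation_mem_ker hn hD)] at this
    exact not_isUnit_zero this
  have h := ringKrullDim_quotient_span_singleton_succ_eq_ringKrullDim_of_mem_nonZeroDivisors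
    (mem_nonZeroDivisors_of_ne_zero (suspensionEquation_ne_zero (K := K) hn hD)) hmem
  rw [MvPowerSeries.ringKrullDim_fin, MvPowerSeries.ringKrullDim_fin, ringKrullDim_eq_zero_of_field,
    zero_add] at h
  have h2 : ((n : WithBot ℕ∞) + (2 : ℕ)) = ((n + 1 : ℕ) : WithBot ℕ∞) + 1 := by
    push_cast; rw [add_assoc, one_add_one_eq_two]
  rw [h2] at h
  exact ENat.WithBot.add_one_cancel.1 h

end DoubleSuspension

/-! ### Lattice point count and its limit -/

section Limit

variable {n : ℕ}

/-- `t ↦ ∏ j, max 0 (1 - D j * t)`. -/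
noncomputable def truncProd (D : Fin n → ℕ) (t : ℝ) : ℝ := ∏ j, max 0 (1 - (D j : ℝ) * t)

theorem truncProd_nonneg (D : Fin n → ℕ) (t : ℝ) : 0 ≤ truncProd D t :=
  Finset.prod_nonneg fun _ _ => le_max_left _ _

theorem truncProd_zero (D : Fin n → ℕ) : truncProd D 0 = 1 := by simp [truncProd]

theorem truncProd_antitone (D : Fin n → ℕ) : Antitone (truncProd D) := fun x y hxy =>
  Finset.prod_le_prod (fun _ _ => le_max_left _ _) fun j _ => by gcongr

theorem continuous_truncProd (D : Fin n → ℕ) : Continuous (truncProd D) := by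
  unfold truncProd
  fun_prop

/-- Comparison of an antitone function's Riemann sum with its integral. -/
theorem Antitone.riemannSum_bounds {F : ℝ → ℝ} (hF : Antitone F) {m : ℕ} (hm : 0 < m) :
    m * (∫ t in (0 : ℝ)..1, F t) ≤ ∑ i ∈ Finset.range m, F (i / m) ∧
      ∑ i ∈ Finset.range m, F (i / m) ≤ m * (∫ t in (0 : ℝ)..1, F t) + F 0 - F 1 := by
  have hm' : (m : ℝ) ≠ 0 := by positivity
  have hG : Antitone fun x : ℝ => F (x / m) := fun x y hxy => hF (by gcongr)
  have hint : ∫ x in (0 : ℝ)..0 + m, F (x / m) = m * ∫ t in (0 : ℝ)..1, F t := by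
    rw [intervalIntegral.integral_comp_div (fun x => F x) hm']
    simp [hm']
  have h1 := AntitoneOn.integral_le_sum (x₀ := 0) (a := m) (hG.antitoneOn _)
  have h2 := AntitoneOn.sum_le_integral (x₀ := 0) (a := m) (hG.antitoneOn _)
  rw [hint] at h1 h2
  simp only [zero_add] at h1 h2
  refine ⟨h1, ?_⟩
  -- The left and right Riemann sums differ by the end terms F(0) - F(1).
  have h3 := Finset.sum_range_succ (fun i : ℕ => F (i / m)) m
  rw [Finset.sum_range_succ'] at h3
  simp only [Nat.cast_zero, zero_div, div_self hm'] at h3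
  linarith

theorem sum_Ioo_natAbs {M : Type*} [AddCommGroup M] (g : ℕ → M) {q : ℕ} (hq : 1 ≤ q) :
    ∑ c ∈ Finset.Ioo (-(q : ℤ)) q, g c.natAbs = 2 • ∑ c ∈ Finset.range q, g c - g 0 := by
  induction q, hq using Nat.le_induction with
  | base =>
    have : Finset.Ioo (-((1 : ℕ) : ℤ)) (1 : ℕ) = {0} := by decide
    rw [this]
    simp [two_nsmul]
  | succ q hq ih =>
    have : Finset.Ioo (-((q + 1 : ℕ) : ℤ)) (q + 1 : ℕ) =
        insert (q : ℤ) (insert (-(q : ℤ)) (Finset.Ioo (-(q : ℤ)) q)) := by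
      ext c
      simp only [Finset.mem_Ioo, Finset.mem_insert]
      omega
    rw [this, Finset.sum_insert, Finset.sum_insert, ih, Finset.sum_range_succ]
    · simp only [Int.natAbs_neg, Int.natAbs_natCast]
      abel
    · simp
    · simp only [Finset.mem_Ioo, Finset.mem_insert]
      omega

/-- Truncated subtraction gives q - d_j c = q max(0, 1 - d_j c/q). Pairing c with -c counts c = 0
twice, hence the -1. -/
theorem card_freeIndex (D : Fin n → ℕ) {q : ℕ} (hq : 1 ≤ q) :
    ((freeIndex D q).card : ℝ) =
      q ^ n * (2 * ∑ c ∈ Finset.range q, truncProd D (c / q) - 1) := by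
  have hq' : (0 : ℝ) < q := by exact_mod_cast hq
  have hterm : ∀ c : ℕ, ((∏ j, (q - D j * c) : ℕ) : ℝ) = q ^ n * truncProd D (c / q) := by
    intro c
    rw [truncProd, ← Fin.prod_const, ← Finset.prod_mul_distrib, Nat.cast_prod]
    refine Finset.prod_congr rfl fun j _ => ?_
    rw [mul_max_of_nonneg _ _ hq'.le, mul_zero]
    have h : (q : ℝ) * (1 - D j * (c / q)) = q - D j * c := by field_simp
    rw [h]
    rcases le_total (D j * c) q with hle | hle
    · rw [Nat.cast_sub hle, max_eq_right]
      · push_cast; ring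
      · rw [sub_nonneg]; exact_mod_cast hle
    · rw [Nat.sub_eq_zero_of_le hle, max_eq_left, Nat.cast_zero]
      rw [sub_nonpos]; exact_mod_cast hle
  rw [freeIndex, Finset.card_sigma]
  simp only [Fintype.card_piFinset, Finset.card_range]
  rw [Nat.cast_sum, sum_Ioo_natAbs (fun c => ((∏ j, (q - D j * c) : ℕ) : ℝ)) hq]
  simp only [hterm]
  rw [← Finset.mul_sum, Nat.cast_zero, zero_div, truncProd_zero, nsmul_eq_mul]
  push_cast
  ring

theorem tendsto_card_freeIndex (D : Fin n → ℕ) :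
    Filter.Tendsto (fun q : ℕ => ((freeIndex D q).card : ℝ) / (q : ℝ) ^ (n + 1)) Filter.atTop
      (nhds (2 * ∫ t in (0 : ℝ)..1, truncProd D t)) := by
  have hinv : Filter.Tendsto (fun q : ℕ => (1 : ℝ) / q) Filter.atTop (nhds 0) :=
    tendsto_one_div_atTop_nhds_zero_nat
  -- Doubling the Riemann sum bounds and subtracting 1 leaves an error of at most 1/q on either
  -- side.
  have hlo := (tendsto_const_nhds (x := 2 * ∫ t in (0 : ℝ)..1, truncProd D t)).sub hinv
  have hhi := (tendsto_const_nhds (x := 2 * ∫ t in (0 : ℝ)..1, truncProd D t)).add hinv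
  rw [sub_zero] at hlo
  rw [add_zero] at hhi
  have hev : ∀ᶠ q : ℕ in Filter.atTop, 1 ≤ q := Filter.eventually_ge_atTop 1
  have hform : ∀ q : ℕ, 1 ≤ q → ((freeIndex D q).card : ℝ) / (q : ℝ) ^ (n + 1) =
      (2 * ∑ c ∈ Finset.range q, truncProd D (c / q) - 1) / q := fun q hq => by
    have hq' : (q : ℝ) ≠ 0 := by positivity
    rw [card_freeIndex D hq, pow_succ, mul_div_mul_left _ _ (pow_ne_zero n hq')]
  refine tendsto_of_tendsto_of_tendsto_of_le_of_le' hlo hhi ?_ ?_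
  · filter_upwards [hev] with q hq
    have hq' : (0 : ℝ) < q := by exact_mod_cast hq
    have := ((truncProd_antitone D).riemannSum_bounds hq).1
    rw [hform q hq, le_div_iff₀ hq', sub_mul, one_div_mul_cancel hq'.ne']
    linarith
  · filter_upwards [hev] with q hq
    have hq' : (0 : ℝ) < q := by exact_mod_cast hq
    have := ((truncProd_antitone D).riemannSum_bounds hq).2
    have h1 := truncProd_nonneg D 1
    rw [truncProd_zero] at this
    rw [hform q hq, div_le_iff₀ hq', add_mul, one_div_mul_cancel hq'.ne']
    linarith

theorem prod_sub_add_mul (d : ℝ) (D : Fin n → ℝ) (s : ℝ) :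
    ∏ j, ((d - D j) + D j * s) = ∑ k ∈ Finset.range (n + 1), symmW d D k * s ^ (n - k) := by
  rw [Finset.prod_add, ← Finset.sum_fiberwise_of_maps_to (t := Finset.range (n + 1))
    (g := Finset.card)]
  · refine Finset.sum_congr rfl fun k _ => ?_
    rw [← Finset.powersetCard_eq_filter, symmW, Finset.sum_mul]
    refine Finset.sum_congr rfl fun J hJ => ?_
    rw [Finset.prod_mul_distrib, Finset.prod_const, Finset.card_sdiff_of_subset (Finset.subset_univ J),
      (Finset.mem_powersetCard.1 hJ).2, Finset.card_univ, Fintype.card_fin, mul_assoc]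
  · intro J _
    rw [Finset.mem_range, Nat.lt_succ_iff]
    simpa using Finset.card_le_univ J

theorem integral_prod_sub_add_mul (d : ℝ) (D : Fin n → ℝ) :
    ∫ s in (0 : ℝ)..1, ∏ j, ((d - D j) + D j * s) =
      ∑ k ∈ Finset.range (n + 1), symmW d D k / ((n : ℝ) - k + 1) := by
  simp_rw [prod_sub_add_mul]
  rw [intervalIntegral.integral_finsetSum fun k _ => (by fun_prop : Continuous fun s : ℝ =>
    symmW d D k * s ^ (n - k)).intervalIntegrable _ _]
  refine Finset.sum_congr rfl fun k hk => ?_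
  rw [intervalIntegral.integral_const_mul, integral_pow,
    Nat.cast_sub (Nat.lt_succ_iff.1 (Finset.mem_range.1 hk))]
  simp [div_eq_mul_inv]

/-- Beyond 1/d the factor with d_j = d vanishes. Before 1/d no truncation occurs, and s = 1 - dt
gives 1 - d_j t = ((d - d_j) + d_j s)/d. -/
theorem integral_truncProd {D : Fin n → ℕ} (hn : 1 ≤ n) (hD : ∀ j, 1 ≤ D j) {d : ℕ}
    (hd : d = Finset.univ.sup D) :
    ∫ t in (0 : ℝ)..1, truncProd D t =
      1 / (d : ℝ) ^ (n + 1) * ∫ s in (0 : ℝ)..1, ∏ j, (((d : ℝ) - D j) + D j * s) := by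
  have hle : ∀ j, D j ≤ d := fun j => hd ▸ Finset.le_sup (Finset.mem_univ j)
  have hd1 : 1 ≤ d := (hD ⟨0, hn⟩).trans (hle _)
  have hd0 : (0 : ℝ) < d := by exact_mod_cast hd1
  obtain ⟨j₀, -, hj₀⟩ := Finset.exists_mem_eq_sup Finset.univ ⟨(⟨0, hn⟩ : Fin n), Finset.mem_univ _⟩ D
  have hint : ∀ a b : ℝ, IntervalIntegrable (truncProd D) MeasureTheory.volume a b :=
    fun a b => (continuous_truncProd D).intervalIntegrable a b
  rw [← intervalIntegral.integral_add_adjacent_intervals (hint 0 (1 / d)) (hint (1 / d) 1)]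
  have hzero : ∫ t in (1 / d : ℝ)..1, truncProd D t = 0 := by
    rw [intervalIntegral.integral_congr (g := fun _ => 0)]
    · simp
    · intro t ht
      rw [Set.uIcc_of_le (by rw [div_le_one hd0]; exact_mod_cast hd1)] at ht
      refine Finset.prod_eq_zero (Finset.mem_univ j₀) (max_eq_left ?_)
      rw [← hj₀, ← hd, sub_nonpos, mul_comm]
      exact (div_le_iff₀ hd0).1 ht.1
  have hsub := intervalIntegral.integral_comp_sub_mul (a := 0) (b := 1 / d)
    (fun s : ℝ => ∏ j, (((d : ℝ) - D j) + D j * s)) hd0.ne' 1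
  rw [mul_one_div_cancel hd0.ne', mul_zero, sub_zero, sub_self, smul_eq_mul] at hsub
  have hcongr : ∫ t in (0 : ℝ)..1 / d, truncProd D t =
      ∫ t in (0 : ℝ)..1 / d, 1 / (d : ℝ) ^ n * ∏ j, (((d : ℝ) - D j) + D j * (1 - d * t)) := by
    refine intervalIntegral.integral_congr fun t ht => ?_
    rw [Set.uIcc_of_le (by positivity)] at ht
    have hdt := (le_div_iff₀' hd0).1 ht.2
    change truncProd D t = _
    rw [truncProd, one_div, ← inv_pow, ← Fin.prod_const, ← Finset.prod_mul_distrib]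
    refine Finset.prod_congr rfl fun j _ => ?_
    have hj : (D j : ℝ) ≤ d := by exact_mod_cast hle j
    have h1 : (D j : ℝ) * t ≤ 1 := (mul_le_mul_of_nonneg_right hj ht.1).trans hdt
    rw [max_eq_right (by linarith)]
    field_simp
    ring
  rw [hzero, add_zero, hcongr, intervalIntegral.integral_const_mul, hsub]
  field_simp
  ring

theorem symmW_zero (d : ℝ) (D : Fin n → ℝ) : symmW d D 0 = ∏ j, D j := by
  simp [symmW]

theorem symmW_card_eq_zero {d : ℝ} {D : Fin n → ℝ} (j : Fin n) (hj : D j = d) :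
    symmW d D n = 0 := by
  have : Finset.powersetCard n (Finset.univ : Finset (Fin n)) = {Finset.univ} := by
    simpa using Finset.powersetCard_self (Finset.univ : Finset (Fin n))
  rw [symmW, this, Finset.sum_singleton, Finset.prod_eq_zero (Finset.mem_univ j), zero_mul]
  rw [hj, sub_self]

/-- The term W_0 is the product of the d_j, and W_n = 0 because some d_j equals d. -/
theorem two_mul_integral_truncProd {D : Fin n → ℕ} (hn : 1 ≤ n) (hD : ∀ j, 1 ≤ D j) {d : ℕ}
    (hd : d = Finset.univ.sup D) :
    2 * ∫ t in (0 : ℝ)..1, truncProd D t =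
      2 / (d : ℝ) ^ (n + 1) * ((∏ j, (D j : ℝ)) / ((n : ℝ) + 1) +
        ∑ s ∈ Finset.Icc 1 (n - 1),
          symmW (d : ℝ) (fun j => (D j : ℝ)) s / ((n : ℝ) - (s : ℝ) + 1)) := by
  obtain ⟨j₀, -, hj₀⟩ := Finset.exists_mem_eq_sup Finset.univ ⟨(⟨0, hn⟩ : Fin n), Finset.mem_univ _⟩ D
  have hW : symmW (d : ℝ) (fun j => (D j : ℝ)) n = 0 :=
    symmW_card_eq_zero j₀ (by simp only [Nat.cast_inj]; rw [hd, hj₀])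
  rw [integral_truncProd hn hD hd, integral_prod_sub_add_mul d fun j => (D j : ℝ),
    Finset.sum_range_succ, hW, zero_div, add_zero, Finset.range_eq_Ico,
    Finset.sum_eq_sum_Ico_succ_bot (by omega), symmW_zero, ← mul_assoc, mul_one_div]
  have : Finset.Icc 1 (n - 1) = Finset.Ico (0 + 1) n := by ext; simp; omega
  rw [this, Nat.cast_zero, sub_zero]

end Limit

theorem theorem6 (p : ℕ) [Fact p.Prime] (K : Type*) [Field K] [CharP K p]
    (hK : FiniteDimensional (frobenius K p).fieldRange K)
    (n : ℕ) (hn : 1 ≤ n) (D : Fin n → ℕ) (hD : ∀ j, 1 ≤ D j)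
    (d : ℕ) (hd : d = Finset.univ.sup D) :
    ∃ (_ : IsLocalRing (DoubleSuspension (MvPowerSeries (Fin n) K) (powerSeriesMonomial K D)))
      (_ : CharP (DoubleSuspension (MvPowerSeries (Fin n) K) (powerSeriesMonomial K D)) p),
      IsNoetherianRing (DoubleSuspension (MvPowerSeries (Fin n) K) (powerSeriesMonomial K D)) ∧
      IsFFinite p (DoubleSuspension (MvPowerSeries (Fin n) K) (powerSeriesMonomial K D)) ∧
      HasFSignature p (DoubleSuspension (MvPowerSeries (Fin n) K) (powerSeriesMonomial K D))
        (2 / (d : ℝ) ^ (n + 1) *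
          ((∏ j, (D j : ℝ)) / ((n : ℝ) + 1) +
            ∑ s ∈ Finset.Icc 1 (n - 1),
              symmW (d : ℝ) (fun j => (D j : ℝ)) s / ((n : ℝ) - (s : ℝ) + 1))) := by
  have hloc := isLocalRing_suspension (K := K) hn hD
  have hchar := charP_suspension (K := K) p hn hD
  refine ⟨hloc, hchar, inferInstance, isFFinite_suspension p hK, n + 1,
    fun e => frobeniusDegree p K ^ e * (freeIndex D (p ^ e)).card,
    ringKrullDim_suspension hn hD, fun e => ?_, ?_⟩
  · obtain ⟨ι, _, b, π, hcard, hb⟩ := exists_isFrobeniusBasis p K hK e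
    simp only [← hcard]
    exact isMaxFreeRank_suspension hn hD hb
  · rw [← two_mul_integral_truncProd hn hD hd, frobeniusDegree_residueField_suspension p hn hD]
    have hp1 : 1 < p := (Fact.out : p.Prime).one_lt
    have hp : (0 : ℝ) < p := by exact_mod_cast hp1.le
    have hN : (0 : ℝ) < frobeniusDegree p K := by
      exact_mod_cast (Module.finrank_pos : 0 < Module.finrank (frobenius K p).fieldRange K)
    refine ((tendsto_card_freeIndex D).comp (tendsto_pow_atTop_atTop_of_one_lt hp1)).congr fun e => ?_
    -- Since p^α = [K:K^p], the factor p^(eα) cancels the number of basis elements of K over K^q.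
    have hexp : (p : ℝ) ^ ((e : ℝ) * (((n + 1 : ℕ) : ℝ) + Real.logb p (frobeniusDegree p K))) =
        (frobeniusDegree p K : ℝ) ^ e * ((p : ℝ) ^ e) ^ (n + 1) := by
      rw [mul_comm, Real.rpow_mul hp.le, Real.rpow_natCast, Real.rpow_add hp,
        Real.rpow_logb hp (by exact_mod_cast hp1.ne') hN, Real.rpow_natCast, mul_pow, mul_comm,
        ← pow_mul, ← pow_mul, mul_comm e]
    rw [hexp]
    simp only [Function.comp_apply]
    push_cast
    rw [mul_div_mul_left _ _ (pow_ne_zero e hN.ne')]
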